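/- Let $\mathbb T=\mathbb R/\mathbb Z$, and for $k\in\mathbb Z$ let $T_k:\mathbb T\to\mathbb T$, $T_kx=kx \bmod 1$. For a Borel probability measure $\mu$ on $\mathbb T$ let $T_k\mu$ be the image measure, $T_k\mu(C)=\mu(T_k^{-1}C)$. Fix an integer $p\ge 2$, let $\mathcal P_p(\mathbb T)$ be the set of Borel probability measures $\mu$ on $\mathbb T$ with $T_p\mu=\mu$, endowed with the topology $w^*$ of weak-star convergence (against continuous functions on $\mathbb T$), and let $\mathcal P_{p,c}(\mathbb T)$ be the set of those $\mu\in\mathcal P_p(\mathbb T)$ that are continuous, i.e. have no atoms. Let $(c_n)_{n\ge 0}$ be a strictly increasing sequence of integers satisfying the following assumption (H): there exist finitely many nonnegative integers $t_1,\dots,t_r,h_1,\dots,h_d$, with $h_l\ne 0$ for every $l$, and an infinite set $I\subseteq\mathbb N$ such that for every $N\in I$ there exist $i\in\{1,\dots,r\}$ and $l\in\{1,\dots,d\}$ with $$h_l c_n\equiv t_i \pmod{p^N-1}\quad\text{for infinitely many } n.$$ Then the set $$G_{p,(c_n)}=\bigl\{\mu\in\mathcal P_{p,c}(\mathbb T)\;:\;T_{c_n}\mu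 \text{ does not converge } w^* \text{ to the normalised Lebesgue measure as } n\to\infty\bigr\}$$ is residual in $(\mathcal P_p(\mathbb T),w^*)$, i.e. it contains a countable intersection of dense open subsets of $\mathcal P_p(\mathbb T)$ (equivalently, since this space is compact and metrizable, a dense $G_\delta$ set). -/

import Mathlib

open MeasureTheory Filter Topology

noncomputable section

namespace TimesP

/-- The map `T_k : x ↦ k x mod 1` of the circle `𝕋 = ℝ / ℤ` into itself. -/
def mulMap (k : ℤ) : UnitAddCircle → UnitAddCircle := fun x => k • x

theorem measurable_mulMap (k : ℤ) : Measurable (mulMap k) :=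
  (continuous_zsmul k).measurable

/-- The image measure `T_k μ`, i.e. `C ↦ μ (T_k⁻¹ C)`. -/
def push (k : ℤ) (μ : ProbabilityMeasure UnitAddCircle) : ProbabilityMeasure UnitAddCircle :=
  μ.map (measurable_mulMap k).aemeasurable

/-- The normalised Lebesgue measure on the circle. -/
def leb : ProbabilityMeasure UnitAddCircle := ⟨volume, ⟨UnitAddCircle.measure_univ⟩⟩

/-- The set of `T_p`-invariant Borel probability measures on the circle. As a subtype of
`ProbabilityMeasure UnitAddCircle` it carries the topology of weak-star convergence. -/
def invariantMeasures (p : ℕ) : Set (ProbabilityMeasure UnitAddCircle) :=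
  {μ | push p μ = μ}

/-- Assumption (H) on the integer sequence `c`, relative to `p`. -/
def AssumptionH (p : ℕ) (c : ℕ → ℤ) : Prop :=
  ∃ (r d : ℕ) (t : Fin r → ℕ) (h : Fin d → ℕ) (I : Set ℕ),
    (∀ l, h l ≠ 0) ∧ I.Infinite ∧
      ∀ N ∈ I, ∃ (i : Fin r) (l : Fin d),
        {n : ℕ | (h l : ℤ) * c n ≡ (t i : ℤ) [ZMOD (p : ℤ) ^ N - 1]}.Infinite

/-- The set of continuous (non-atomic) `T_p`-invariant probability measures `μ` for which
`T_{c n} μ` does not converge weak-star to the Lebesgue measure. -/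
def nonEquidistributed (p : ℕ) (c : ℕ → ℤ) : Set (invariantMeasures p) :=
  {μ | (∀ x : UnitAddCircle, (μ.1 : Measure UnitAddCircle) {x} = 0) ∧
    ¬ Tendsto (fun n : ℕ => push (c n) μ.1) atTop (𝓝 leb)}

end TimesP

end

/-!
Let `μ` be a `T_p`-invariant measure. Move every point of the circle to a nearest point of the
finite set of nonfixed points of period `N`, and average the first `N` iterated images of the
transported measure: this is an invariant measure `ν_N` on that set. Points are moved by at most
`2 / (p ^ N - 1)`, and this error grows by a factor `p` with each iterate, so its average over the
`N` iterates is `O(1 / N)` and `ν_N → μ`.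

* For prime `N` every orbit in the set has `N` points, so the atoms of `ν_N` have mass at most
  `1 / N`. Hence a generic invariant measure has no atoms.
* Points of period `N` are `(p ^ N - 1)`-torsion, so the Fourier coefficients of `ν_N` depend on the
  frequency modulo `p ^ N - 1` only. By the pigeonhole principle, assumption (H) holds with a single
  `h` and a single `t`, and then `ν_N` has the same coefficient at `h c_n` as at `t`, for infinitely
  many `n`. The coefficient at `t` can be made nonzero by mixing in a little of `δ₀`. Hence
  `2 |μ̂(h c_n)| > |μ̂(t)| > 0` infinitely often for a generic invariant `μ`, whereas
  `T_{c_n} μ → Leb` would force `μ̂(h c_n) → 0`.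
-/

noncomputable section

open Function Set BoundedContinuousFunction
open scoped ENNReal NNReal unitInterval

namespace TimesP

section CesaroMeasure

variable {X : Type*} [MeasurableSpace X] {T : X → X} {N : ℕ} {μ : Measure X}

/-- The Cesàro average of the first `N` iterated images of `μ` under `T`, the usual device for
producing `T`-invariant measures. It is the zero measure when `N = 0`. -/
def cesaroMeasure (T : X → X) (N : ℕ) (μ : Measure X) : Measure X :=
  (N : ℝ≥0∞)⁻¹ • ∑ j ∈ Finset.range N, μ.map T^[j]

theorem cesaroMeasure_apply (hT : Measurable T) {s : Set X} (hs : MeasurableSet s) :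
    cesaroMeasure T N μ s = (N : ℝ≥0∞)⁻¹ * ∑ j ∈ Finset.range N, μ (T^[j] ⁻¹' s) := by
  simp only [cesaroMeasure, Measure.smul_apply, Measure.finsetSum_apply, smul_eq_mul,
    Measure.map_apply (hT.iterate _) hs]

theorem isProbabilityMeasure_cesaroMeasure [IsProbabilityMeasure μ] (hT : Measurable T)
    (hN : N ≠ 0) : IsProbabilityMeasure (cesaroMeasure T N μ) := by
  refine ⟨?_⟩
  rw [cesaroMeasure_apply hT MeasurableSet.univ]
  simp [ENNReal.inv_mul_cancel (Nat.cast_ne_zero.2 hN) (ENNReal.natCast_ne_top N)]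

theorem measurePreserving_cesaroMeasure (hT : Measurable T) (hμ : μ.map T^[N] = μ) :
    MeasurePreserving T (cesaroMeasure T N μ) (cesaroMeasure T N μ) := by
  refine ⟨hT, ?_⟩
  have hmap (j : ℕ) : (μ.map T^[j]).map T = μ.map T^[j + 1] := by
    rw [Measure.map_map hT (hT.iterate j), ← iterate_succ']
  have hshift : ∑ j ∈ Finset.range N, μ.map T^[j + 1] = ∑ j ∈ Finset.range N, μ.map T^[j] := by
    cases N with
    | zero => rfl
    | succ M =>
      rw [Finset.sum_range_succ, hμ, Finset.sum_range_succ' fun j ↦ μ.map T^[j], iterate_zero,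
        Measure.map_id]
  rw [cesaroMeasure, Measure.map_smul, Measure.map_finset_sum hT.aemeasurable]
  simp only [hmap, hshift]

theorem cesaroMeasure_eq_self (hμ : MeasurePreserving T μ μ) (hN : N ≠ 0) :
    cesaroMeasure T N μ = μ := by
  simp only [cesaroMeasure, (hμ.iterate _).map_eq, Finset.sum_const, Finset.card_range]
  rw [← Nat.cast_smul_eq_nsmul ℝ≥0∞, smul_smul,
    ENNReal.inv_mul_cancel (Nat.cast_ne_zero.2 hN) (ENNReal.natCast_ne_top N), one_smul]

theorem ae_mem_cesaroMeasure {S : Set X} (hT : Measurable T) (hS : MeasurableSet S)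
    (hTS : MapsTo T S S) (hμ : ∀ᵐ x ∂μ, x ∈ S) : ∀ᵐ x ∂cesaroMeasure T N μ, x ∈ S := by
  rw [ae_iff, ← compl_def, cesaroMeasure_apply hT hS.compl]
  have hnull (j : ℕ) : μ (T^[j] ⁻¹' Sᶜ) = 0 :=
    measure_mono_null (fun x hx hxS ↦ hx (hTS.iterate j hxS)) hμ
  simp only [hnull, Finset.sum_const_zero, mul_zero]

variable [TopologicalSpace X] [OpensMeasurableSpace X]

theorem integrable_birkhoffAverage [IsFiniteMeasure μ] (hT : Measurable T) (f : X →ᵇ ℝ) :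
    Integrable (birkhoffAverage ℝ T f N) μ :=
  (integrable_finsetSum _ fun j _ ↦ (f.integrable _).comp_measurable (hT.iterate j)).smul (N : ℝ)⁻¹

theorem integral_cesaroMeasure [IsFiniteMeasure μ] (hT : Measurable T) (f : X →ᵇ ℝ) :
    ∫ x, f x ∂cesaroMeasure T N μ = ∫ x, birkhoffAverage ℝ T f N x ∂μ := by
  have hint (j : ℕ) : Integrable (fun x ↦ f (T^[j] x)) μ :=
    (f.integrable _).comp_measurable (hT.iterate j)
  have hmap (j : ℕ) : ∫ x, f x ∂μ.map T^[j] = ∫ x, f (T^[j] x) ∂μ :=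
    integral_map (hT.iterate j).aemeasurable (f.integrable _).aestronglyMeasurable
  simp only [birkhoffAverage, birkhoffSum, integral_smul]
  rw [cesaroMeasure, integral_smul_measure,
    integral_finsetSum_measure fun j _ ↦ f.integrable (μ.map T^[j]),
    integral_finsetSum _ fun j _ ↦ hint j]
  simp only [hmap, ENNReal.toReal_inv, ENNReal.toReal_natCast]

end CesaroMeasure

section PeriodicApproximation

variable {X : Type*} [PseudoMetricSpace X] {T : X → X} {N : ℕ} {δ : ℝ} {L : ℝ≥0}

theorem dist_birkhoffAverage_le {f : X → ℝ} {K : ℝ≥0} (hT : LipschitzWith L T)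
    (hf : LipschitzWith K f) {x y : X} (hxy : dist x y ≤ δ) :
    dist (birkhoffAverage ℝ T f N x) (birkhoffAverage ℝ T f N y) ≤
      K * ((∑ j ∈ Finset.range N, (L : ℝ) ^ j) * δ) / N := by
  refine (dist_birkhoffAverage_birkhoffAverage_le ℝ T f N x y).trans ?_
  rw [Finset.sum_mul, Finset.mul_sum]
  gcongr with j
  calc dist (f (T^[j] x)) (f (T^[j] y)) ≤ K * dist (T^[j] x) (T^[j] y) := hf.dist_le_mul _ _
    _ ≤ K * ((L ^ j : ℝ≥0) * dist x y) := by gcongr; exact (hT.iterate j).dist_le_mul x y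
    _ ≤ K * ((L : ℝ) ^ j * δ) := by rw [NNReal.coe_pow]; gcongr

variable [MeasurableSpace X] [OpensMeasurableSpace X] {S : Set X}

theorem exists_measurable_forall_mem_dist_le (hS : S.Finite) (hδ : ∀ x, ∃ y ∈ S, dist y x ≤ δ) :
    ∃ φ : X → X, Measurable φ ∧ (∀ x, φ x ∈ S) ∧ ∀ x, dist (φ x) x ≤ δ := by
  rcases isEmpty_or_nonempty X with hX | ⟨⟨x₀⟩⟩
  · exact ⟨id, measurable_id, isEmptyElim, isEmptyElim⟩
  obtain ⟨e, rfl⟩ := hS.countable.exists_eq_range ((hδ x₀).imp fun _ h ↦ h.1)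
  choose! index hindex using fun y (hy : y ∈ range e) ↦ hy
  obtain ⟨n, hn⟩ := (hS.image index).bddAbove
  refine ⟨SimpleFunc.nearestPt e n, SimpleFunc.measurable _, fun x ↦ ?_, fun x ↦ ?_⟩
  · exact mem_range_self (SimpleFunc.nearestPtInd e n x)
  · obtain ⟨y, hy, hyx⟩ := hδ x
    refine le_trans ?_ hyx
    have hnearest := SimpleFunc.edist_nearestPt_le e x (hn (mem_image_of_mem index hy))
    rw [hindex y hy, edist_dist, edist_dist] at hnearest
    exact (ENNReal.ofReal_le_ofReal_iff dist_nonneg).1 hnearest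

variable [BorelSpace X] {μ : Measure X} [IsProbabilityMeasure μ]

theorem dist_integral_cesaroMeasure_map_le {φ : X → X} (hT : LipschitzWith L T)
    (hμ : MeasurePreserving T μ μ) (hN : N ≠ 0) (hφ : Measurable φ)
    (hδ : ∀ x, dist (φ x) x ≤ δ) {f : X →ᵇ ℝ} {K : ℝ≥0} (hf : LipschitzWith K f) :
    dist (∫ x, f x ∂cesaroMeasure T N (μ.map φ)) (∫ x, f x ∂μ) ≤
      K * ((∑ j ∈ Finset.range N, (L : ℝ) ^ j) * δ) / N := by
  have hTm := hT.continuous.measurable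
  have hint : Integrable (birkhoffAverage ℝ T f N) (μ.map φ) := integrable_birkhoffAverage hTm f
  have hintφ : Integrable (fun x ↦ birkhoffAverage ℝ T f N (φ x)) μ := hint.comp_measurable hφ
  have hintμ : Integrable (birkhoffAverage ℝ T f N) μ := integrable_birkhoffAverage hTm f
  have hrounded : ∫ x, f x ∂cesaroMeasure T N (μ.map φ) =
      ∫ x, birkhoffAverage ℝ T f N (φ x) ∂μ := by
    rw [integral_cesaroMeasure hTm, integral_map hφ.aemeasurable hint.aestronglyMeasurable]
  have hself : ∫ x, f x ∂μ = ∫ x, birkhoffAverage ℝ T f N x ∂μ := by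
    rw [← integral_cesaroMeasure hTm, cesaroMeasure_eq_self hμ hN]
  rw [hrounded, hself, dist_eq_norm, ← integral_sub hintφ hintμ]
  refine (norm_integral_le_of_norm_le_const (Eventually.of_forall fun x ↦ ?_)).trans_eq
    (by rw [probReal_univ, mul_one])
  rw [← dist_eq_norm]
  exact dist_birkhoffAverage_le hT hf (hδ x)

theorem exists_measurePreserving_ae_mem_dist_integral_le (hT : LipschitzWith L T)
    (hμ : MeasurePreserving T μ μ) (hN : N ≠ 0) (hS : S.Finite) (hSm : MeasurableSet S)
    (hper : S ⊆ ptsOfPeriod T N) (hTS : MapsTo T S S) (hδ : ∀ x, ∃ y ∈ S, dist y x ≤ δ) :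
    ∃ ν : ProbabilityMeasure X, MeasurePreserving T ν ν ∧ (∀ᵐ x ∂(ν : Measure X), x ∈ S) ∧
      ∀ (f : X →ᵇ ℝ) (K : ℝ≥0), LipschitzWith K f →
        dist (∫ x, f x ∂(ν : Measure X)) (∫ x, f x ∂μ) ≤
          K * ((∑ j ∈ Finset.range N, (L : ℝ) ^ j) * δ) / N := by
  obtain ⟨φ, hφ, hφS, hφδ⟩ := exists_measurable_forall_mem_dist_le hS hδ
  have hTm := hT.continuous.measurable
  have hφμ : (μ.map φ).map T^[N] = μ.map φ := by
    rw [Measure.map_map (hTm.iterate N) hφ]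
    exact congrArg μ.map (funext fun x ↦ hper (hφS x))
  have := Measure.isProbabilityMeasure_map (μ := μ) hφ.aemeasurable
  exact ⟨⟨cesaroMeasure T N (μ.map φ), isProbabilityMeasure_cesaroMeasure hTm hN⟩,
    measurePreserving_cesaroMeasure hTm hφμ,
    ae_mem_cesaroMeasure hTm hSm hTS ((ae_map_iff hφ.aemeasurable hSm).2 (ae_of_all _ hφS)),
    fun f K hf ↦ dist_integral_cesaroMeasure_map_le hT hμ hN hφ hφδ hf⟩

end PeriodicApproximation

section Atoms

variable {X : Type*} [MeasurableSpace X] [MetricSpace X] [BorelSpace X]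

theorem isClosed_setOf_le_measure_singleton (ε : ℝ≥0∞) :
    IsClosed {q : ProbabilityMeasure X × X | ε ≤ (q.1 : Measure X) {q.2}} := by
  rw [isClosed_iff_ultrafilter]
  rintro ⟨μ, x⟩ u hu hmem
  have hball {r : ℝ} (hr : 0 < r) : ε ≤ (μ : Measure X) (Metric.closedBall x r) := by
    have hlimsup := ProbabilityMeasure.limsup_measure_closed_le_of_tendsto
      ((continuous_fst.tendsto (μ, x)).mono_left hu) (Metric.isClosed_closedBall (x := x) (ε := r))
    refine le_trans (le_limsup_of_frequently_le (Eventually.frequently ?_)) hlimsup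
    filter_upwards [hmem, hu (continuous_snd.tendsto (μ, x) (Metric.closedBall_mem_nhds x hr))]
      with q hq hqx
    exact hq.trans (measure_mono (singleton_subset_iff.2 hqx))
  have hlim := tendsto_measure_cthickening_of_isClosed (μ := (μ : Measure X)) (s := {x})
    ⟨1, one_pos, measure_ne_top _ _⟩ isClosed_singleton
  refine ge_of_tendsto (hlim.mono_left (nhdsWithin_le_nhds (s := Ioi 0))) ?_
  filter_upwards [self_mem_nhdsWithin] with r hr
  rw [Metric.cthickening_singleton x (le_of_lt hr)]
  exact hball hr

theorem isClosed_setOf_exists_le_measure_singleton [CompactSpace X] (ε : ℝ≥0∞) :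
    IsClosed {μ : ProbabilityMeasure X | ∃ x, ε ≤ (μ : Measure X) {x}} := by
  convert! isClosedMap_fst_of_compactSpace _ (isClosed_setOf_le_measure_singleton (X := X) ε)
  ext μ
  simp

theorem forall_measure_singleton_eq_zero_mem_residual [CompactSpace X]
    {S : Set (ProbabilityMeasure X)}
    (hS : ∀ ε > 0, Dense {μ : S | ∀ x, (μ.1 : Measure X) {x} < ε}) :
    {μ : S | ∀ x, (μ.1 : Measure X) {x} = 0} ∈ residual S := by
  have hsmall (k : ℕ) : ∀ᶠ μ : S in residual S, ∀ x, (μ.1 : Measure X) {x} < (k : ℝ≥0∞)⁻¹ := by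
    refine residual_of_dense_open ?_ (hS _ (by simp))
    have hopen := (isClosed_setOf_exists_le_measure_singleton (X := X) (k : ℝ≥0∞)⁻¹).isOpen_compl
    simpa [compl_def] using hopen.preimage (continuous_subtype_val (p := (· ∈ S)))
  filter_upwards [eventually_countable_forall.2 hsmall] with μ hμ x
  by_contra hx
  obtain ⟨k, hk⟩ := ENNReal.exists_inv_nat_lt hx
  exact lt_asymm hk (hμ k x)

end Atoms

section NonfixedPeriodicPts

variable {X : Type*} {T : X → X} {N : ℕ}

/-- The points `x` with `T^[N] x = x` which are not fixed by `T`. For prime `N` these are the points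
of minimal period `N`. -/
def nonfixedPeriodicPts (T : X → X) (N : ℕ) : Set X :=
  ptsOfPeriod T N \ fixedPoints T

theorem mapsTo_nonfixedPeriodicPts (hN : 0 < N) :
    MapsTo T (nonfixedPeriodicPts T N) (nonfixedPeriodicPts T N) := by
  rintro x ⟨hx, hfix⟩
  refine ⟨(bijOn_ptsOfPeriod T hN).mapsTo hx, fun hTx ↦ hfix ?_⟩
  rw [mem_fixedPoints, ← minimalPeriod_eq_one_iff_isFixedPt] at hTx ⊢
  rwa [minimalPeriod_apply (mk_mem_periodicPts hN hx)] at hTx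

variable [MeasurableSpace X] [MeasurableSingletonClass X] {μ : Measure X} [IsProbabilityMeasure μ]

theorem minimalPeriod_mul_measure_singleton_le_one (hT : MeasurePreserving T μ μ) (x : X) :
    minimalPeriod T x * μ {x} ≤ 1 := by
  have hle (j : ℕ) : μ {x} ≤ μ {T^[j] x} :=
    calc μ {x} ≤ μ (T^[j] ⁻¹' {T^[j] x}) := measure_mono (singleton_subset_iff.2 rfl)
      _ = μ {T^[j] x} :=
        (hT.iterate j).measure_preimage (measurableSet_singleton _).nullMeasurableSet
  have hdisj : (Finset.range (minimalPeriod T x) : Set ℕ).PairwiseDisjoint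
      fun j ↦ ({T^[j] x} : Set X) := by
    rw [Finset.coe_range]
    exact fun _ hi _ hj hij ↦
      disjoint_singleton.2 (iterate_injOn_Iio_minimalPeriod.ne hi hj hij)
  calc minimalPeriod T x * μ {x} = ∑ _ ∈ Finset.range (minimalPeriod T x), μ {x} := by
        rw [Finset.sum_const, Finset.card_range, nsmul_eq_mul]
    _ ≤ ∑ j ∈ Finset.range (minimalPeriod T x), μ {T^[j] x} := Finset.sum_le_sum fun j _ ↦ hle j
    _ = μ (⋃ j ∈ Finset.range (minimalPeriod T x), {T^[j] x}) :=
        (measure_biUnion_finset hdisj fun _ _ ↦ measurableSet_singleton _).symm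
    _ ≤ 1 := prob_le_one

theorem measure_singleton_le_inv_of_ae_mem_nonfixedPeriodicPts (hN : N.Prime)
    (hT : MeasurePreserving T μ μ) (hμ : ∀ᵐ x ∂μ, x ∈ nonfixedPeriodicPts T N) (x : X) :
    μ {x} ≤ (N : ℝ≥0∞)⁻¹ := by
  rcases eq_or_ne (μ {x}) 0 with hx | hx
  · simp [hx]
  obtain ⟨hper, hfix⟩ : x ∈ nonfixedPeriodicPts T N := by
    by_contra hxN
    exact hx (measure_mono_null (singleton_subset_iff.2 hxN) hμ)
  have := Fact.mk hN
  rw [ENNReal.le_inv_iff_mul_le, mul_comm, ← minimalPeriod_eq_prime hper hfix]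
  exact minimalPeriod_mul_measure_singleton_le_one hT x

end NonfixedPeriodicPts

section Circle

variable {k : ℤ} {p N q : ℕ}

theorem mulMap_iterate (k : ℤ) (n : ℕ) : (mulMap k)^[n] = mulMap (k ^ n) :=
  smul_iterate k n

theorem isFixedPt_mulMap_iff {x : UnitAddCircle} : IsFixedPt (mulMap k) x ↔ (k - 1) • x = 0 := by
  rw [IsFixedPt, mulMap, sub_smul, one_smul, sub_eq_zero]

theorem isPeriodicPt_mulMap_iff {x : UnitAddCircle} :
    IsPeriodicPt (mulMap k) N x ↔ (k ^ N - 1) • x = 0 := by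
  rw [IsPeriodicPt, mulMap_iterate, isFixedPt_mulMap_iff]

theorem lipschitzWith_mulMap (k : ℤ) : LipschitzWith ‖k‖₊ (mulMap k) :=
  LipschitzWith.of_dist_le_mul fun x y ↦ by
    simpa only [mulMap, dist_eq_norm, ← zsmul_sub, coe_nnnorm] using norm_zsmul_le k (x - y)

theorem mem_invariantMeasures_iff {μ : ProbabilityMeasure UnitAddCircle} :
    μ ∈ invariantMeasures p ↔
      MeasurePreserving (mulMap p) (μ : Measure UnitAddCircle) (μ : Measure UnitAddCircle) :=
  ProbabilityMeasure.toMeasure_injective.eq_iff.symm.trans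
    ⟨fun h ↦ ⟨measurable_mulMap p, h⟩, fun h ↦ h.map_eq⟩

theorem exists_nsmul_eq_zero_dist_le (hq : 0 < q) (x : UnitAddCircle) :
    ∃ y : UnitAddCircle, q • y = 0 ∧ dist y x ≤ 1 / q := by
  have hq' : (0 : ℝ) < q := Nat.cast_pos.2 hq
  obtain ⟨r, rfl⟩ := QuotientAddGroup.mk_surjective x
  refine ⟨((round (q * r) / q : ℝ) : UnitAddCircle), ?_, ?_⟩
  · rw [← AddCircle.coe_nsmul, nsmul_eq_mul, mul_div_cancel₀ _ hq'.ne', AddCircle.coe_eq_zero_iff]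
    exact ⟨round (q * r), by simp⟩
  · calc dist ((round (q * r) / q : ℝ) : UnitAddCircle) r
        = ‖((round (q * r) / q - r : ℝ) : UnitAddCircle)‖ := dist_eq_norm _ _
      _ ≤ |round (q * r) / q - r| := QuotientAddGroup.norm_mk_le_norm
      _ = |q * r - round (q * r)| / q := by
        rw [div_sub' hq'.ne', abs_div, abs_of_pos hq', abs_sub_comm]
      _ ≤ 1 / q := by gcongr; linarith [abs_sub_round (q * r)]

theorem exists_nsmul_eq_zero_zsmul_ne_zero_dist_le {a : ℤ} (hq : 0 < q) (ha : ¬(q : ℤ) ∣ a)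
    (x : UnitAddCircle) : ∃ y : UnitAddCircle, q • y = 0 ∧ a • y ≠ 0 ∧ dist y x ≤ 2 / q := by
  obtain ⟨y, hy, hyx⟩ := exists_nsmul_eq_zero_dist_le hq x
  have hle : (1 : ℝ) / q ≤ 2 / q := by gcongr; norm_num
  by_cases hay : a • y = 0
  swap
  · exact ⟨y, hy, hay, hyx.trans hle⟩
  set u : UnitAddCircle := ((1 / q : ℝ) : UnitAddCircle)
  have horder : addOrderOf u = q := AddCircle.addOrderOf_period_div hq
  have hnorm : ‖u‖ ≤ 1 / q :=
    QuotientAddGroup.norm_mk_le_norm.trans_eq (Real.norm_of_nonneg (by positivity))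
  refine ⟨y + u, ?_, ?_, ?_⟩
  · rw [nsmul_add, hy, zero_add, ← horder, addOrderOf_nsmul_eq_zero]
  · rwa [zsmul_add, hay, zero_add, Ne, ← addOrderOf_dvd_iff_zsmul_eq_zero, horder]
  · calc dist (y + u) x ≤ dist (y + u) y + dist y x := dist_triangle _ _ _
      _ ≤ 1 / q + 1 / q := by gcongr; rwa [dist_self_add_left]
      _ = 2 / q := by ring

theorem finite_nonfixedPeriodicPts_mulMap (hk : k ^ N ≠ 1) :
    (nonfixedPeriodicPts (mulMap k) N).Finite := by
  have hreg : IsSMulRegular ℝ (k ^ N - 1) :=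
    .of_right_eq_zero_of_smul fun r hr ↦ (smul_eq_zero.1 hr).resolve_left (sub_ne_zero.2 hk)
  exact (AddCircle.finite_torsion_of_isSMulRegular_int 1 _ hreg).subset fun x hx ↦
    isPeriodicPt_mulMap_iff.1 hx.1

theorem exists_mem_nonfixedPeriodicPts_dist_le (hp : 2 ≤ p) (hN : 2 ≤ N) (x : UnitAddCircle) :
    ∃ y ∈ nonfixedPeriodicPts (mulMap p) N, dist y x ≤ 2 / ((p : ℝ) ^ N - 1) := by
  have hpN : p < p ^ N := lt_self_pow₀ hp hN
  have hcast : ((p ^ N - 1 : ℕ) : ℤ) = (p : ℤ) ^ N - 1 := by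
    rw [Nat.cast_pred (by lia), Nat.cast_pow]
  have hndvd : ¬((p ^ N - 1 : ℕ) : ℤ) ∣ p - 1 := fun hdvd ↦ by
    have := Int.le_of_dvd (by lia) hdvd
    lia
  obtain ⟨y, hy, hfix, hyx⟩ := exists_nsmul_eq_zero_zsmul_ne_zero_dist_le (by lia) hndvd x
  refine ⟨y, ⟨?_, fun h ↦ hfix (isFixedPt_mulMap_iff.1 h)⟩, ?_⟩
  · rwa [mem_ptsOfPeriod, isPeriodicPt_mulMap_iff, ← hcast, natCast_zsmul]
  · rwa [Nat.cast_pred (by lia), Nat.cast_pow] at hyx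

theorem exists_invariantMeasure_ae_mem_nonfixedPeriodicPts (hp : 2 ≤ p) (hN : 2 ≤ N)
    (μ : invariantMeasures p) :
    ∃ ν : invariantMeasures p,
      (∀ᵐ x ∂(ν.1 : Measure UnitAddCircle), x ∈ nonfixedPeriodicPts (mulMap p) N) ∧
      ∀ (f : UnitAddCircle →ᵇ ℝ) (K : ℝ≥0), LipschitzWith K f →
        dist (∫ x, f x ∂(ν.1 : Measure UnitAddCircle)) (∫ x, f x ∂(μ.1 : Measure UnitAddCircle)) ≤
          K * (2 / (p - 1)) / N := by
  have hp1 : (1 : ℝ) < p := Nat.one_lt_cast.2 hp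
  have hpN : (0 : ℝ) < (p : ℝ) ^ N - 1 := sub_pos.2 (one_lt_pow₀ hp1 (by lia))
  have hgeom : (∑ j ∈ Finset.range N, (‖(p : ℤ)‖₊ : ℝ) ^ j) * (2 / ((p : ℝ) ^ N - 1)) =
      2 / (p - 1) := by
    rw [coe_nnnorm, Int.norm_natCast, geom_sum_eq hp1.ne']
    field_simp
  have hfin := finite_nonfixedPeriodicPts_mulMap (k := p) (N := N)
    (one_lt_pow₀ (by exact_mod_cast hp) (by lia)).ne'
  obtain ⟨ν, hν, hνS, hνμ⟩ := exists_measurePreserving_ae_mem_dist_integral_le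
    (lipschitzWith_mulMap p) (mem_invariantMeasures_iff.1 μ.2) (by lia) hfin hfin.measurableSet
    sdiff_subset (mapsTo_nonfixedPeriodicPts (by lia))
    (exists_mem_nonfixedPeriodicPts_dist_le hp hN)
  simp only [hgeom] at hνμ
  exact ⟨⟨ν, mem_invariantMeasures_iff.2 hν⟩, hνS, hνμ⟩

theorem exists_tendsto_ae_mem_nonfixedPeriodicPts (hp : 2 ≤ p) (μ : invariantMeasures p) :
    ∃ ν : ℕ → invariantMeasures p, Tendsto ν atTop (𝓝 μ) ∧ ∀ N ≥ 2,
      ∀ᵐ x ∂((ν N).1 : Measure UnitAddCircle), x ∈ nonfixedPeriodicPts (mulMap p) N := by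
  have : Nonempty (invariantMeasures p) := ⟨μ⟩
  choose! ν hν hνμ using fun N (hN : 2 ≤ N) ↦
    exists_invariantMeasure_ae_mem_nonfixedPeriodicPts hp hN μ
  refine ⟨ν, ?_, hν⟩
  rw [tendsto_subtype_rng, tendsto_iff_forall_lipschitz_integral_tendsto]
  rintro f ⟨C, hC⟩ ⟨K, hf⟩
  rw [tendsto_iff_dist_tendsto_zero]
  refine squeeze_zero' (Eventually.of_forall fun _ ↦ dist_nonneg) ?_
    (tendsto_const_div_atTop_nhds_zero_nat (K * (2 / (p - 1) : ℝ)))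
  filter_upwards [eventually_ge_atTop 2] with N hN
  exact hνμ N hN (mkOfBound ⟨f, hf.continuous⟩ C hC) K hf

theorem dense_forall_measure_singleton_lt (hp : 2 ≤ p) {ε : ℝ≥0∞} (hε : 0 < ε) :
    Dense {μ : invariantMeasures p | ∀ x, (μ.1 : Measure UnitAddCircle) {x} < ε} := by
  intro μ
  obtain ⟨ν, hνμ, hν⟩ := exists_tendsto_ae_mem_nonfixedPeriodicPts hp μ
  refine mem_closure_of_frequently_of_tendsto ?_ hνμ
  obtain ⟨n, hn⟩ := ENNReal.exists_inv_nat_lt hε.ne'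
  refine frequently_atTop.2 fun M ↦ ?_
  obtain ⟨N, hMN, hN⟩ := Nat.exists_infinite_primes (max M n)
  refine ⟨N, le_of_max_le_left hMN, fun x ↦ ?_⟩
  calc ((ν N).1 : Measure UnitAddCircle) {x}
    _ ≤ (N : ℝ≥0∞)⁻¹ := measure_singleton_le_inv_of_ae_mem_nonfixedPeriodicPts hN
        (mem_invariantMeasures_iff.1 (ν N).2) (hν N hN.two_le) x
    _ ≤ (n : ℝ≥0∞)⁻¹ := by gcongr; exact le_of_max_le_right hMN
    _ < ε := hn

theorem eventually_residual_forall_measure_singleton_eq_zero (hp : 2 ≤ p) :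
    ∀ᶠ μ : invariantMeasures p in residual _, ∀ x, (μ.1 : Measure UnitAddCircle) {x} = 0 :=
  forall_measure_singleton_eq_zero_mem_residual fun _ hε ↦ dense_forall_measure_singleton_lt hp hε

end Circle

section Mixture

variable {X : Type*} [MeasurableSpace X]

/-- The convex combination `(1 - s) μ + s ν` of two probability measures. -/
def mixture (s : I) (μ ν : ProbabilityMeasure X) : ProbabilityMeasure X :=
  ⟨unitInterval.toNNReal (σ s) • (μ : Measure X) + unitInterval.toNNReal s • (ν : Measure X), by
    refine ⟨?_⟩
    rw [Measure.add_apply, Measure.smul_apply, Measure.smul_apply, measure_univ, measure_univ,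
      ← add_smul, unitInterval.toNNReal_symm_add_toNNReal, one_smul]⟩

variable {s : I} {μ ν : ProbabilityMeasure X}

theorem mixture_zero : mixture 0 μ ν = μ := by
  apply ProbabilityMeasure.toMeasure_injective
  simp [mixture]

theorem measurePreserving_mixture {T : X → X}
    (hμ : MeasurePreserving T (μ : Measure X) (μ : Measure X))
    (hν : MeasurePreserving T (ν : Measure X) (ν : Measure X)) :
    MeasurePreserving T (mixture s μ ν : Measure X) (mixture s μ ν : Measure X) :=
  (hμ.smul_measure _).add_measure (hν.smul_measure _)

theorem integral_mixture {E : Type*} [NormedAddCommGroup E] [NormedSpace ℝ E] {f : X → E}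
    (hμ : Integrable f μ) (hν : Integrable f ν) :
    ∫ x, f x ∂(mixture s μ ν : Measure X) =
      (1 - s : ℝ) • ∫ x, f x ∂(μ : Measure X) + (s : ℝ) • ∫ x, f x ∂(ν : Measure X) := by
  rw [mixture, ProbabilityMeasure.coe_mk, integral_add_measure hμ.smul_measure_nnreal
    hν.smul_measure_nnreal, integral_smul_nnreal_measure, integral_smul_nnreal_measure]
  rfl

theorem continuous_mixture [TopologicalSpace X] [OpensMeasurableSpace X] :
    Continuous fun s ↦ mixture s μ ν := by
  refine continuous_iff_continuousAt.2 fun s ↦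
    ProbabilityMeasure.tendsto_iff_forall_integral_tendsto.2 fun f ↦ ?_
  simp only [integral_mixture (f.integrable _) (f.integrable _)]
  exact Continuous.tendsto (by fun_prop) s

end Mixture

section FourierStieltjes

/-- The Fourier–Stieltjes coefficient `∫ e(k x) dμ(x)`, where `e(x) = exp (2 π i x)`. -/
def fourierStieltjesCoeff (k : ℤ) (μ : ProbabilityMeasure UnitAddCircle) : ℂ :=
  ∫ x, fourier k x ∂(μ : Measure UnitAddCircle)

theorem integrable_fourier (k : ℤ) (μ : Measure UnitAddCircle) [IsFiniteMeasure μ] :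
    Integrable (fun x ↦ fourier k x) μ :=
  (mkOfCompact (fourier k)).integrable μ

theorem continuous_fourierStieltjesCoeff (k : ℤ) : Continuous (fourierStieltjesCoeff k) :=
  continuous_iff_continuousAt.2 fun _ ↦
    (ProbabilityMeasure.tendsto_iff_forall_integral_rclike_tendsto ℂ).1 tendsto_id
      (mkOfCompact (fourier k))

theorem fourierStieltjesCoeff_push (k m : ℤ) (μ : ProbabilityMeasure UnitAddCircle) :
    fourierStieltjesCoeff k (push m μ) = fourierStieltjesCoeff (k * m) μ := by
  simp only [fourierStieltjesCoeff, push, ProbabilityMeasure.toMeasure_map]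
  rw [integral_map (measurable_mulMap m).aemeasurable
    (fourier k).continuous.aestronglyMeasurable]
  simp only [fourier_apply, mulMap, smul_smul]

theorem fourierStieltjesCoeff_leb {k : ℤ} (hk : k ≠ 0) : fourierStieltjesCoeff k leb = 0 := by
  have h := congrFun (fourierCoeff_fourier (T := (1 : ℝ)) k) 0
  rw [Pi.single_eq_of_ne hk.symm, fourierCoeff, AddCircle.integral_haarAddCircle] at h
  simpa [fourierStieltjesCoeff, leb] using h

theorem fourierStieltjesCoeff_diracProba_zero (k : ℤ) :
    fourierStieltjesCoeff k (diracProba 0) = 1 := by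
  simp [fourierStieltjesCoeff, diracProba]

theorem fourierStieltjesCoeff_mixture (k : ℤ) (s : I) (μ ν : ProbabilityMeasure UnitAddCircle) :
    fourierStieltjesCoeff k (mixture s μ ν) =
      (1 - s : ℝ) • fourierStieltjesCoeff k μ + (s : ℝ) • fourierStieltjesCoeff k ν :=
  integral_mixture (integrable_fourier k _) (integrable_fourier k _)

theorem fourierStieltjesCoeff_congr {q k m : ℤ} {μ : ProbabilityMeasure UnitAddCircle}
    (hμ : ∀ᵐ x ∂(μ : Measure UnitAddCircle), q • x = 0) (h : k ≡ m [ZMOD q]) :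
    fourierStieltjesCoeff k μ = fourierStieltjesCoeff m μ := by
  refine integral_congr_ae ?_
  filter_upwards [hμ] with x hx
  obtain ⟨r, hr⟩ := h.dvd
  obtain rfl : m = k + r * q := by linarith
  rw [fourier_apply, fourier_apply, add_zsmul, mul_zsmul, hx, zsmul_zero, add_zero]

theorem diracProba_zero_mem_invariantMeasures (p : ℕ) : diracProba 0 ∈ invariantMeasures p :=
  mem_invariantMeasures_iff.2 ⟨measurable_mulMap p, by
    rw [diracProba, ProbabilityMeasure.coe_mk, Measure.map_dirac' (measurable_mulMap p), mulMap,
      zsmul_zero]⟩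

theorem dense_fourierStieltjesCoeff_ne_zero (p : ℕ) (t : ℤ) :
    Dense {μ : invariantMeasures p | fourierStieltjesCoeff t μ.1 ≠ 0} := by
  intro μ
  by_cases hμ : fourierStieltjesCoeff t μ.1 = 0
  swap
  · exact subset_closure hμ
  let mix (s : I) : invariantMeasures p := ⟨mixture s μ.1 (diracProba 0),
    mem_invariantMeasures_iff.2 <| measurePreserving_mixture (mem_invariantMeasures_iff.1 μ.2)
      (mem_invariantMeasures_iff.1 (diracProba_zero_mem_invariantMeasures p))⟩
  have hmix : Continuous mix := continuous_mixture.subtype_mk _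
  have hmix0 : mix 0 = μ := Subtype.ext mixture_zero
  rw [← hmix0]
  refine map_mem_closure hmix (dense_compl_singleton 0 0) fun s hs ↦ ?_
  have hcoeff : fourierStieltjesCoeff t (mix s).1 = (s : ℝ) := by
    rw [fourierStieltjesCoeff_mixture, hμ, fourierStieltjesCoeff_diracProba_zero]
    simp
  simpa [hcoeff] using hs

end FourierStieltjes

section Resonance

variable {p : ℕ} {t : ℤ} {k : ℕ → ℤ}

theorem AssumptionH.exists_frequently_modEq {c : ℕ → ℤ} (hH : AssumptionH p c) :
    ∃ h t : ℤ, h ≠ 0 ∧ ∃ᶠ N in atTop, ∃ᶠ n in atTop, h * c n ≡ t [ZMOD (p : ℤ) ^ N - 1] := by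
  obtain ⟨r, d, t, h, J, hh, hJ, hcong⟩ := hH
  have hfreq : ∃ᶠ N in atTop, ∃ (i : Fin r) (l : Fin d), ∃ᶠ n in atTop,
      (h l : ℤ) * c n ≡ t i [ZMOD (p : ℤ) ^ N - 1] :=
    (Nat.frequently_atTop_iff_infinite.2 hJ).mono fun N hN ↦ by
      simpa only [Nat.frequently_atTop_iff_infinite] using hcong N hN
  simp only [frequently_exists] at hfreq
  obtain ⟨i, l, hil⟩ := hfreq
  exact ⟨h l, t i, Nat.cast_ne_zero.2 (hh l), hil⟩

theorem dense_exists_lt_norm_fourierStieltjesCoeff (hp : 2 ≤ p)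
    (hk : ∃ᶠ N in atTop, ∃ᶠ n in atTop, k n ≡ t [ZMOD (p : ℤ) ^ N - 1]) (M : ℕ) :
    Dense {μ : invariantMeasures p | ∃ n ≥ M,
      ‖fourierStieltjesCoeff t μ.1‖ / 2 < ‖fourierStieltjesCoeff (k n) μ.1‖} := by
  refine Dense.of_closure ((dense_fourierStieltjesCoeff_ne_zero p t).mono fun μ hμ ↦ ?_)
  obtain ⟨ν, hνμ, hν⟩ := exists_tendsto_ae_mem_nonfixedPeriodicPts hp μ
  have hcoeff : Tendsto (fun N ↦ fourierStieltjesCoeff t (ν N).1) atTop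
      (𝓝 (fourierStieltjesCoeff t μ.1)) :=
    ((continuous_fourierStieltjesCoeff t).comp continuous_subtype_val).tendsto μ |>.comp hνμ
  refine mem_closure_of_frequently_of_tendsto ?_ hνμ
  refine (hk.and_eventually ((eventually_ge_atTop 2).and (hcoeff.eventually_ne hμ))).mono ?_
  rintro N ⟨hN, hN2, hne⟩
  obtain ⟨n, hn, hMn⟩ := (hN.and_eventually (eventually_ge_atTop M)).exists
  have htorsion : ∀ᵐ x ∂((ν N).1 : Measure UnitAddCircle), ((p : ℤ) ^ N - 1) • x = 0 :=
    (hν N hN2).mono fun x hx ↦ isPeriodicPt_mulMap_iff.1 hx.1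
  refine ⟨n, hMn, ?_⟩
  rw [fourierStieltjesCoeff_congr htorsion hn]
  exact half_lt_self (norm_pos_iff.2 hne)

theorem eventually_residual_frequently_lt_norm_fourierStieltjesCoeff (hp : 2 ≤ p)
    (hk : ∃ᶠ N in atTop, ∃ᶠ n in atTop, k n ≡ t [ZMOD (p : ℤ) ^ N - 1]) :
    ∀ᶠ μ : invariantMeasures p in residual _, ∃ᶠ n in atTop,
      ‖fourierStieltjesCoeff t μ.1‖ / 2 < ‖fourierStieltjesCoeff (k n) μ.1‖ := by
  simp only [frequently_atTop]
  refine eventually_countable_forall.2 fun M ↦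
    residual_of_dense_open ?_ (dense_exists_lt_norm_fourierStieltjesCoeff hp hk M)
  have hcont (m : ℤ) : Continuous fun μ : invariantMeasures p ↦ fourierStieltjesCoeff m μ.1 :=
    (continuous_fourierStieltjesCoeff m).comp continuous_subtype_val
  simp only [ofPred_exists, ofPred_and]
  exact isOpen_iUnion fun n ↦ isOpen_const.inter
    (isOpen_lt ((hcont t).norm.div_const 2) (hcont (k n)).norm)

theorem eventually_residual_fourierStieltjesCoeff_ne_zero (p : ℕ) (t : ℤ) :
    ∀ᶠ μ : invariantMeasures p in residual _, fourierStieltjesCoeff t μ.1 ≠ 0 :=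
  residual_of_dense_open (isOpen_ne_fun
    ((continuous_fourierStieltjesCoeff t).comp continuous_subtype_val) continuous_const)
    (dense_fourierStieltjesCoeff_ne_zero p t)

theorem tendsto_fourierStieltjesCoeff_of_tendsto_push {c : ℕ → ℤ} {h : ℤ}
    {μ : ProbabilityMeasure UnitAddCircle} (hh : h ≠ 0)
    (hμ : Tendsto (fun n ↦ push (c n) μ) atTop (𝓝 leb)) :
    Tendsto (fun n ↦ fourierStieltjesCoeff (h * c n) μ) atTop (𝓝 0) := by
  simpa only [comp_def, fourierStieltjesCoeff_push, fourierStieltjesCoeff_leb hh] using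
    ((continuous_fourierStieltjesCoeff h).tendsto leb).comp hμ

end Resonance

end TimesP

end

open TimesP in
theorem theorem2p10_general (p : ℕ) (hp : 2 ≤ p) (c : ℕ → ℤ) (hH : AssumptionH p c) :
    nonEquidistributed p c ∈ residual (invariantMeasures p) := by
  obtain ⟨h, t, hh, hfreq⟩ := hH.exists_frequently_modEq
  filter_upwards [eventually_residual_forall_measure_singleton_eq_zero hp,
    eventually_residual_fourierStieltjesCoeff_ne_zero p t,
    eventually_residual_frequently_lt_norm_fourierStieltjesCoeff hp hfreq] with μ hatom hne hlarge
  refine ⟨hatom, fun hlim ↦ hlarge ?_⟩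
  have hsmall := (tendsto_fourierStieltjesCoeff_of_tendsto_push hh hlim).norm
  rw [norm_zero] at hsmall
  filter_upwards [hsmall.eventually_lt_const (half_pos (norm_pos_iff.2 hne))] with n hn
  exact hn.not_gt

theorem theorem2p10 (p : ℕ) (hp : 2 ≤ p) (c : ℕ → ℤ) (hc : StrictMono c)
    (hH : TimesP.AssumptionH p c) :
    TimesP.nonEquidistributed p c ∈ residual (TimesP.invariantMeasures p) :=
  theorem2p10_general p hp c hH
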